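/- Let $\mathbb A$ be a finite set, let $s\ge 1$ be an integer, and let $\{X_t\}_{t\ge 0}$ be a stationary $\mathbb A$-valued process that is $s$-step Markov, i.e. for every $t\ge s$ the conditional distribution of $X_t$ given $X_0,\dots,X_{t-1}$ equals its conditional distribution given $X_{t-s},\dots,X_{t-1}$. Let $\mu_{\mathbf i}=\Pr\{X_t\cdots X_{t+s}=\mathbf i\}$, $\mathbf i\in\mathbb A^{s+1}$, be its $(s+1)$-tuple frequency vector, and suppose that $\mu_{\mathbf i}>0$ for all $\mathbf i\in\mathbb A^{s+1}$. For a vector $\nu$ on $\mathbb A^{k+1}$ put $\bar\nu_{\mathbf i}=\sum_{j\in\mathbb A}\nu_{\mathbf i j}$, $\mathbf i\in\mathbb A^{k}$. A probability distribution $\nu$ on $\mathbb A^{k}$ is called stationary if $k=1$, or if $k\ge 2$, $\sum_{j}\nu_{\mathbf i j}=\sum_j\nu_{j\mathbf i}$ for all $\mathbf i\in\mathbb A^{k-1}$, and $\bar\nu$ is stationary. Let $\mathcal M_s(\mathbb A^{k})$ be the set of stationary distributions on $\mathbb A^{k}$ with the total variation ($\ell_1$) topology. Let $D(\nu\Vert\mu)=\sum_{\mathbf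 i}\nu_{\mathbf i}\log(\nu_{\mathbf i}/\mu_{\mathbf i})$ denote relative entropy ($0\log 0=0$). For $l\ge s$ and a sample path $x_1\cdots x_l$ of the process, let $\tilde x_1\cdots\tilde x_{l+s}=x_1\cdots x_l\,x_1\cdots x_s$ be the path augmented by $s$ ghost transitions, and define the empirical distribution $$\nu_{\mathbf i}(x_1^l)=\frac1l\sum_{t=1}^{l}\mathbf 1\{\tilde x_t\cdots\tilde x_{t+s}=\mathbf i\},\qquad \mathbf i\in\mathbb A^{s+1}.$$ Then $\mu\in\mathcal M_s(\mathbb A^{s+1})$, $\nu(x_1^l)\in\mathcal M_s(\mathbb A^{s+1})$ for all $l\ge s$, and the $\mathcal M_s(\mathbb A^{s+1})$-valued process $\{\nu(X_1^l)\}_{l\ge s}$ satisfies the large deviation property with rate function $$I(\nu)=D_c(\nu\Vert\mu):=D(\nu\Vert\mu)-D(\bar\nu\Vert\bar\mu).$$ That is, $I:\mathcal M_s(\mathbb A^{s+1})\to\mathbb R\cup\{\infty\}$ is lower semicontinuous, and $$-\inf_{\nu\in\Gamma}I(\nu)\le\liminf_{l\to\infty}\frac1l\log\Pr\{\nu(X_1^l)\in\Gamma\}\quad\text{for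 every open }\Gamma\subseteq\mathcal M_s(\mathbb A^{s+1}),$$ $$\limsup_{l\to\infty}\frac1l\log\Pr\{\nu(X_1^l)\in\Gamma\}\le-\inf_{\nu\in\Gamma}I(\nu)\quad\text{for every closed }\Gamma\subseteq\mathcal M_s(\mathbb A^{s+1}),$$ with the conventions $\log 0=-\infty$ and $\inf\emptyset=+\infty$. -/

import Mathlib

open MeasureTheory ProbabilityTheory Filter Topology

namespace MarkovLDP

noncomputable section

/-- The reduced vector `ν̄` on `A^k` of a vector `ν` on `A^(k+1)`: `ν̄_i = ∑_j ν_{ij}`. -/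
def reduce {A : Type*} [Fintype A] {k : ℕ} (ν : (Fin (k + 1) → A) → ℝ) : (Fin k → A) → ℝ :=
  fun i => ∑ j : A, ν (Fin.snoc i j)

/-- Consistency of a vector indexed by `k`-tuples. For `k ≥ 2` the sum over the last letter and the
sum over the first letter agree, and the reduced vector is again consistent. For `k ≤ 1` there is no
condition. -/
def IsConsistent {A : Type*} [Fintype A] : (k : ℕ) → ((Fin k → A) → ℝ) → Prop
  | 0, _ => True
  | 1, _ => True
  | k + 2, ν =>
      (∀ i : Fin (k + 1) → A, ∑ j : A, ν (Fin.snoc i j) = ∑ j : A, ν (Fin.cons j i)) ∧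
        IsConsistent (k + 1) (reduce ν)

/-- The set `M_s(A^k)` of stationary (consistent) probability distributions on `A^k`. As a subtype
of a finite-dimensional real vector space it carries the topology of the total variation metric. -/
def stationaryDist (A : Type*) [Fintype A] (k : ℕ) : Set ((Fin k → A) → ℝ) :=
  {ν | ν ∈ stdSimplex ℝ (Fin k → A) ∧ IsConsistent k ν}

open Classical in
/-- Relative entropy `D(ν‖μ) = ∑_i ν_i log (ν_i / μ_i)`, with `0 log 0 = 0`, and with value `∞`
if `ν` charges a point that `μ` does not charge. -/
def relEntropy {ι : Type*} [Fintype ι] (ν μ : ι → ℝ) : EReal :=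
  if ∀ i, μ i = 0 → ν i = 0 then ((∑ i, ν i * Real.log (ν i / μ i) : ℝ) : EReal) else ⊤

/-- Conditional relative entropy `D_c(ν‖μ) = D(ν‖μ) - D(ν̄‖μ̄)`. -/
def condRelEntropy {A : Type*} [Fintype A] {k : ℕ} (ν μ : (Fin (k + 1) → A) → ℝ) : EReal :=
  relEntropy ν μ - relEntropy (reduce ν) (reduce μ)

/-- A process `X_0, X_1, …` with values in a finite set is stationary: the probability of seeing a
given finite string does not depend on the starting time. -/
def IsStationary {Ω A : Type*} [MeasurableSpace Ω] (P : Measure Ω) (X : ℕ → Ω → A) : Prop :=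
  ∀ (k t : ℕ) (i : Fin k → A),
    P {ω | ∀ j : Fin k, X (t + j) ω = i j} = P {ω | ∀ j : Fin k, X j ω = i j}

/-- The `s`-step Markov property: for `t ≥ s`, the conditional law of `X_t` given
`X_0, …, X_{t-1}` is its conditional law given `X_{t-s}, …, X_{t-1}`. -/
def IsMultiStepMarkov {Ω A : Type*} [MeasurableSpace Ω] (P : Measure Ω) (s : ℕ)
    (X : ℕ → Ω → A) : Prop :=
  ∀ t : ℕ, s ≤ t → ∀ x : ℕ → A, P {ω | ∀ r, r < t → X r ω = x r} ≠ 0 →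
    P[{ω | X t ω = x t} | {ω | ∀ r, r < t → X r ω = x r}] =
      P[{ω | X t ω = x t} | {ω | ∀ r, t - s ≤ r → r < t → X r ω = x r}]

/-- The `k`-tuple frequency vector `μ_i = P(X_0 … X_{k-1} = i)`; for a stationary process
the starting time is immaterial. -/
def tupleFreq {Ω A : Type*} [MeasurableSpace Ω] (P : Measure Ω) (X : ℕ → Ω → A) (k : ℕ) :
    (Fin k → A) → ℝ :=
  fun i => P.real {ω | ∀ j : Fin k, X j ω = i j}

/-- The sample path `x_1 … x_l` followed by the ghost letters `x_1, x_2, …`: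
positions `1, …, l` carry `x_1, …, x_l` and position `l + j` carries `x_j`. Only the positions
`1, …, l + s` are used below, so that for `l ≥ s` the path is `x_1 … x_l x_1 … x_s`. -/
def augmentedPath {A : Type*} (l : ℕ) (x : ℕ → A) : ℕ → A :=
  fun t => if t ≤ l then x t else x (t - l)

open Classical in
/-- The empirical `(s+1)`-tuple distribution of the sample path `x_1 … x_l` with `s` ghost
transitions: `ν_i = (1/l) ∑_{t=1}^l 1[x̃_t … x̃_{t+s} = i]`, where `x̃` is the augmented path. -/
def empirical {A : Type*} (s l : ℕ) (x : ℕ → A) : (Fin (s + 1) → A) → ℝ :=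
  fun i => (1 / (l : ℝ)) *
    ∑ t ∈ Finset.Icc 1 l, if ∀ j : Fin (s + 1), augmentedPath l x (t + j) = i j then 1 else 0

/-- The large deviation property with rate function `I` on the space `S` for a process `Z_l` which
takes its values in the subset `S` of `E` for all large `l`. "Open" and "closed" refer to the
subspace topology of `S`; logarithms, infima and limits are taken in the extended reals, with
`log 0 = -∞`. -/
structure SatisfiesLDP {Ω E : Type*} [MeasurableSpace Ω] [TopologicalSpace E] (P : Measure Ω)
    (S : Set E) (Z : ℕ → Ω → E) (I : S → EReal) : Prop where
  mem : ∀ᶠ l in atTop, ∀ ω, Z l ω ∈ S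
  ne_bot : ∀ ν, I ν ≠ ⊥
  lowerSemicontinuous : LowerSemicontinuous I
  lower_bound : ∀ Γ : Set S, IsOpen Γ →
    -(⨅ ν ∈ Γ, I ν) ≤
      liminf (fun l : ℕ => ENNReal.log (P {ω | Z l ω ∈ Subtype.val '' Γ}) / (l : EReal)) atTop
  upper_bound : ∀ Γ : Set S, IsClosed Γ →
    limsup (fun l : ℕ => ENNReal.log (P {ω | Z l ω ∈ Subtype.val '' Γ}) / (l : EReal)) atTop ≤
      -(⨅ ν ∈ Γ, I ν)

end

end MarkovLDP

/-!
The empirical frequencies of `(s + 1)`-tuples determine the probability of a path up to a bounded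
factor, and the proof is the method of types built on this fact, with one change: no path is ever
counted. All estimates compare the weight of a closed path under two families of transition
probabilities.

With `transition ν (i j) = ν (i j) / ν̄ i`, the product of the transition probabilities along a
closed path of length `l` with frequency vector `τ` is `exp (l ∑ τ log (transition ν))`
(`cycleWeight_eq_exp`). Passing from an open path to the closed one costs a factor that does not
depend on `l`. Taking `ν = τ` as a second family gives the ratio `exp (-l D_c(τ‖ν))`, and as the
path weights for `transition τ` add up to at most the number of initial words, the words of type `τ`
have total weight at most `C exp (-l D_c(τ‖ν))` under the path law of a positive `ν`
(`sum_pathWeight_type_le`). There are only polynomially many types, and all of them are stationary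
distributions because the frequencies are taken cyclically. This gives the upper bound
(`exists_freqProb_le`).

For the lower bound near a positive stationary `ν`, the path law of `ν` is compared with that of `μ`
(`mul_pathWeight_le_pathWeight`). The density is, up to a constant, the exponential of `-l` times a
linear function of the frequency vector, whose value at `ν` is `D_c(ν‖μ)`. It remains to know that
under the law of `ν` the frequencies are close to `ν` with probability at least `1 / 2`
(`eventually_half_le_freqProb`). This needs no ergodic theorem: it is the upper bound, applied to
`ν` itself, since `D_c(·‖ν)` is nonnegative and vanishes among shift invariant laws only at `ν`
(`eq_of_condDiv_eq_zero`), the invariant law of a positive transition kernel being unique. A general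
stationary `ν` is the limit of the positive ones `(1 - δ) ν + δ μ`, and `D_c(·‖μ)` is continuous.
-/

namespace MarkovLDP

noncomputable section

section

/-! ### Tuples and transition kernels -/

/-- Sum over tuples of length `k + 1`, with the last letter summed innermost. -/
lemma sum_snoc {A M : Type*} [Fintype A] [AddCommMonoid M] {k : ℕ} (f : (Fin (k + 1) → A) → M) :
    ∑ i, f i = ∑ i : Fin k → A, ∑ j : A, f (Fin.snoc i j) := by
  rw [← (Fin.snocEquiv fun _ : Fin (k + 1) => A).sum_comp, Fintype.sum_prod_type, Finset.sum_comm]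
  rfl

/-- The word of length `k` that the sequence `x` shows from time `t` on. -/
def window {A : Type*} (k t : ℕ) (x : ℕ → A) : Fin k → A := fun j => x (t + j)

lemma init_window {A : Type*} (k t : ℕ) (x : ℕ → A) :
    Fin.init (window (k + 1) t x) = window k t x := rfl

lemma snoc_window {A : Type*} (k t : ℕ) (x : ℕ → A) :
    (Fin.snoc (window k t x) (x (t + k)) : Fin (k + 1) → A) = window (k + 1) t x :=
  Fin.snoc_init_self (window (k + 1) t x)

lemma cons_window {A : Type*} (k t : ℕ) (x : ℕ → A) :
    (Fin.cons (x t) (window k (t + 1) x) : Fin (k + 1) → A) = window (k + 1) t x := by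
  funext j
  refine Fin.cases ?_ (fun j => ?_) j
  · simp [window]
  · simp [window, add_assoc, add_comm 1]

variable {A : Type*} [Fintype A] {s : ℕ}

/-- The transition probabilities attached to a vector on `(s + 1)`-tuples:
`transition ν (i j) = ν (i j) / ν̄ i` is the conditional probability of the letter `j` after the
word `i`. It is zero when `ν̄ i = 0`. -/
def transition (ν : (Fin (s + 1) → A) → ℝ) : (Fin (s + 1) → A) → ℝ :=
  fun i => ν i / reduce ν (Fin.init i)

/-- The marginals over the first `s` and over the last `s` letters agree. -/
def IsShiftInvariant (ν : (Fin (s + 1) → A) → ℝ) : Prop :=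
  ∀ i : Fin s → A, reduce ν i = ∑ j : A, ν (Fin.cons j i)

lemma sum_reduce (ν : (Fin (s + 1) → A) → ℝ) : ∑ i, reduce ν i = ∑ i, ν i := (sum_snoc ν).symm

lemma sum_mul_init (ν : (Fin (s + 1) → A) → ℝ) (f : (Fin s → A) → ℝ) :
    ∑ i, ν i * f (Fin.init i) = ∑ i, reduce ν i * f i := by
  simp [sum_snoc, reduce, Finset.sum_mul]

lemma reduce_nonneg {ν : (Fin (s + 1) → A) → ℝ} (h : ∀ i, 0 ≤ ν i) (i : Fin s → A) :
    0 ≤ reduce ν i := Finset.sum_nonneg fun _ _ => h _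

lemma le_reduce_init {ν : (Fin (s + 1) → A) → ℝ} (h : ∀ i, 0 ≤ ν i) (i : Fin (s + 1) → A) :
    ν i ≤ reduce ν (Fin.init i) := by
  conv_lhs => rw [← Fin.snoc_init_self i]
  exact Finset.single_le_sum (f := fun j => ν (Fin.snoc (Fin.init i) j)) (fun _ _ => h _)
    (Finset.mem_univ (i (Fin.last s)))

lemma reduce_pos [Nonempty A] {ν : (Fin (s + 1) → A) → ℝ} (h : ∀ i, 0 < ν i) (i : Fin s → A) :
    0 < reduce ν i := Finset.sum_pos (fun _ _ => h _) Finset.univ_nonempty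

lemma transition_nonneg {ν : (Fin (s + 1) → A) → ℝ} (h : ∀ i, 0 ≤ ν i) (i : Fin (s + 1) → A) :
    0 ≤ transition ν i := div_nonneg (h i) (reduce_nonneg h _)

lemma transition_le_one {ν : (Fin (s + 1) → A) → ℝ} (h : ∀ i, 0 ≤ ν i) (i : Fin (s + 1) → A) :
    transition ν i ≤ 1 := div_le_one_of_le₀ (le_reduce_init h i) (reduce_nonneg h _)

lemma transition_pos {ν : (Fin (s + 1) → A) → ℝ} (h : ∀ i, 0 ≤ ν i) {i : Fin (s + 1) → A}
    (hi : 0 < ν i) : 0 < transition ν i := div_pos hi (hi.trans_le (le_reduce_init h i))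

lemma sum_transition (ν : (Fin (s + 1) → A) → ℝ) (i : Fin s → A) :
    ∑ j, transition ν (Fin.snoc i j) = reduce ν i / reduce ν i := by
  simp [transition, ← Finset.sum_div, reduce]

lemma reduce_mul_transition {ν : (Fin (s + 1) → A) → ℝ} (h : ∀ i, 0 ≤ ν i)
    (i : Fin (s + 1) → A) : reduce ν (Fin.init i) * transition ν i = ν i := by
  rcases (reduce_nonneg h (Fin.init i)).eq_or_lt with h0 | h0
  · have := le_reduce_init h i
    rw [← h0] at this ⊢
    rw [zero_mul, le_antisymm this (h i)]
  · exact mul_div_cancel₀ _ h0.ne'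

/-! ### Conditional relative entropy -/

/-- The real number `∑ τ log τ - ∑ τ̄ log τ̄ - ∑ τ log (transition ν)`. For a nonnegative `τ` and a
positive `ν` it is the conditional relative entropy of `τ` with respect to `ν`; this way of writing
it makes sense, and is continuous in `τ`, on the whole vector space. -/
def condDiv (τ ν : (Fin (s + 1) → A) → ℝ) : ℝ :=
  (∑ i, τ i * Real.log (τ i)) - (∑ i, reduce τ i * Real.log (reduce τ i))
    - ∑ i, τ i * Real.log (transition ν i)

lemma continuous_condDiv (ν : (Fin (s + 1) → A) → ℝ) : Continuous fun τ => condDiv τ ν := by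
  have h : ∀ i : Fin s → A, Continuous fun τ : (Fin (s + 1) → A) → ℝ => reduce τ i := fun i => by
    unfold reduce; fun_prop
  unfold condDiv
  refine (Continuous.sub ?_ ?_).sub (by fun_prop)
  · exact continuous_finsetSum _ fun i _ => Real.continuous_mul_log.comp (continuous_apply i)
  · exact continuous_finsetSum _ fun i _ => Real.continuous_mul_log.comp (h i)

lemma mul_log_div {x y : ℝ} (hy : 0 < y) :
    x * Real.log (x / y) = x * Real.log x - x * Real.log y := by
  rcases eq_or_ne x 0 with rfl | hx
  · simp
  · rw [Real.log_div hx hy.ne', mul_sub]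

lemma condRelEntropy_eq [Nonempty A] (τ : (Fin (s + 1) → A) → ℝ)
    {ν : (Fin (s + 1) → A) → ℝ} (hν : ∀ i, 0 < ν i) :
    condRelEntropy τ ν = ((condDiv τ ν : ℝ) : EReal) := by
  unfold condRelEntropy relEntropy
  rw [if_pos fun i h => absurd h (hν i).ne', if_pos fun i h => absurd h (reduce_pos hν i).ne',
    ← EReal.coe_sub]
  congr 1
  simp only [mul_log_div (hν _), mul_log_div (reduce_pos hν _), Finset.sum_sub_distrib, condDiv,
    transition, Real.log_div (hν _).ne' (reduce_pos hν _).ne', mul_sub]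
  rw [sum_mul_init τ fun i => Real.log (reduce ν i)]
  ring

lemma condDiv_eq_sum_log_sub {τ : (Fin (s + 1) → A) → ℝ} (hτ : ∀ i, 0 ≤ τ i)
    (ν : (Fin (s + 1) → A) → ℝ) :
    condDiv τ ν =
      (∑ i, τ i * Real.log (transition τ i)) - ∑ i, τ i * Real.log (transition ν i) := by
  unfold condDiv
  rw [← sum_mul_init τ fun i => Real.log (reduce τ i), ← Finset.sum_sub_distrib]
  congr 1
  refine Finset.sum_congr rfl fun i _ => ?_
  rcases (hτ i).eq_or_lt with h | h
  · simp [← h]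
  · rw [transition, Real.log_div h.ne' (h.trans_le (le_reduce_init hτ i)).ne', mul_sub]

/-- The inequality `t - u ≤ t log (t / u)` with its equality case; `u` is written `b q` and `t / u`
as a quotient of transition probabilities. -/
lemma sub_le_mul_log_sub {t b q : ℝ} (ht : 0 ≤ t) (htb : t ≤ b) (hq : 0 < q) :
    t - b * q ≤ t * Real.log (t / b) - t * Real.log q ∧
      (t - b * q = t * Real.log (t / b) - t * Real.log q → t = b * q) := by
  rcases ht.eq_or_lt with rfl | ht
  · simp only [zero_mul, zero_sub, sub_zero]
    exact ⟨neg_nonpos.2 (mul_nonneg htb hq.le), fun h => by linarith⟩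
  · have hb := ht.trans_le htb
    have hu : 0 < b * q := mul_pos hb hq
    have e : t * Real.log (t / b) - t * Real.log q - (t - b * q) =
        (b * q) * InformationTheory.klFun (t / (b * q)) := by
      rw [InformationTheory.klFun_apply, Real.log_div ht.ne' hb.ne', Real.log_div ht.ne' hu.ne',
        Real.log_mul hb.ne' hq.ne']
      field_simp
      ring
    refine ⟨sub_nonneg.1 (e ▸ mul_nonneg hu.le
      (InformationTheory.klFun_nonneg (div_nonneg ht.le hu.le))), fun h => ?_⟩
    rw [← h, sub_self, eq_comm, mul_eq_zero, or_iff_right hu.ne',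
      InformationTheory.klFun_eq_zero_iff (div_nonneg ht.le hu.le), div_eq_one_iff_eq hu.ne'] at e
    exact e

lemma sum_reduce_mul_transition [Nonempty A] (τ : (Fin (s + 1) → A) → ℝ)
    {ν : (Fin (s + 1) → A) → ℝ} (hν : ∀ i, 0 < ν i) :
    ∑ i, reduce τ (Fin.init i) * transition ν i = ∑ i, τ i := by
  rw [sum_snoc, ← sum_reduce]
  refine Finset.sum_congr rfl fun i _ => ?_
  simp_rw [Fin.init_snoc, ← Finset.mul_sum]
  rw [sum_transition, div_self (reduce_pos hν i).ne', mul_one]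

lemma condDiv_eq_sum {τ : (Fin (s + 1) → A) → ℝ} (hτ : ∀ i, 0 ≤ τ i)
    (ν : (Fin (s + 1) → A) → ℝ) :
    condDiv τ ν = ∑ i, (τ i * Real.log (τ i / reduce τ (Fin.init i))
      - τ i * Real.log (transition ν i)) := by
  rw [condDiv_eq_sum_log_sub hτ, ← Finset.sum_sub_distrib]
  rfl

lemma condDiv_nonneg [Nonempty A] {τ ν : (Fin (s + 1) → A) → ℝ} (hτ : ∀ i, 0 ≤ τ i)
    (hν : ∀ i, 0 < ν i) : 0 ≤ condDiv τ ν := by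
  have h : ∑ i, (τ i - reduce τ (Fin.init i) * transition ν i) ≤ condDiv τ ν := by
    rw [condDiv_eq_sum hτ]
    exact Finset.sum_le_sum fun i _ => (sub_le_mul_log_sub (hτ i) (le_reduce_init hτ i)
      (transition_pos (fun i => (hν i).le) (hν i))).1
  rwa [Finset.sum_sub_distrib, sum_reduce_mul_transition τ hν, sub_self] at h

lemma eq_reduce_mul_transition_of_condDiv_eq_zero [Nonempty A] {τ ν : (Fin (s + 1) → A) → ℝ}
    (hτ : ∀ i, 0 ≤ τ i) (hν : ∀ i, 0 < ν i) (h : condDiv τ ν = 0) (i : Fin (s + 1) → A) :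
    τ i = reduce τ (Fin.init i) * transition ν i := by
  have key := fun i => sub_le_mul_log_sub (hτ i) (le_reduce_init hτ i)
      (transition_pos (fun i => (hν i).le) (hν i))
  have h2 : ∑ i, (τ i - reduce τ (Fin.init i) * transition ν i) = condDiv τ ν := by
    rw [Finset.sum_sub_distrib, sum_reduce_mul_transition τ hν, sub_self, h]
  rw [condDiv_eq_sum hτ, Finset.sum_eq_sum_iff_of_le fun i _ => (key i).1] at h2
  exact (key i).2 (h2 i (Finset.mem_univ i))

/-- Uniqueness of the invariant law of a positive transition kernel, in the form of a zero-one law: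
if an invariant vector vanishes at one word then it vanishes at every word, because every word leads
to every other one in `s` steps of positive probability. -/
lemma reduce_eq_zero_of_exists {σ q : (Fin (s + 1) → A) → ℝ} (hσ : ∀ i, 0 ≤ σ i)
    (hinv : IsShiftInvariant σ) (hq : ∀ i, 0 < q i)
    (hσq : ∀ i, σ i = reduce σ (Fin.init i) * q i) {i₀ : Fin s → A} (h0 : reduce σ i₀ = 0)
    (i : Fin s → A) : reduce σ i = 0 := by
  have key : ∀ (x : ℕ → A) (t : ℕ), reduce σ (window s t x) = 0 → reduce σ (window s 0 x) = 0 := by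
    intro x t
    induction t with
    | zero => exact id
    | succ t ih =>
      intro h
      refine ih ?_
      rw [hinv, Finset.sum_eq_zero_iff_of_nonneg fun _ _ => hσ _] at h
      have h1 := h (x t) (Finset.mem_univ _)
      rw [cons_window, hσq, init_window] at h1
      exact (mul_eq_zero.1 h1).resolve_right (hq _).ne'
  rcases Nat.eq_zero_or_pos s with rfl | hs
  · rwa [Subsingleton.elim i i₀]
  -- the sequence that reads the word `i`, and then the word `i₀`
  let x : ℕ → A := fun u => if h : u < s then i ⟨u, h⟩ else i₀ ⟨(u - s) % s, Nat.mod_lt _ hs⟩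
  have e1 : window s s x = i₀ := by
    funext j
    simp [window, x, Nat.mod_eq_of_lt j.2]
  have e2 : window s 0 x = i := by
    funext j
    simp [window, x]
  exact e2 ▸ key x s (e1 ▸ h0)

/-- A shift invariant law is determined by its transition probabilities if these are positive, so
that the conditional relative entropy separates shift invariant laws. -/
lemma eq_of_condDiv_eq_zero [Nonempty A] {τ ν : (Fin (s + 1) → A) → ℝ} (hτ : ∀ i, 0 ≤ τ i)
    (hν : ∀ i, 0 < ν i) (hτi : IsShiftInvariant τ) (hνi : IsShiftInvariant ν)
    (hsum : ∑ i, τ i = ∑ i, ν i) (h : condDiv τ ν = 0) : τ = ν := by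
  have hν' : ∀ i, 0 ≤ ν i := fun i => (hν i).le
  have hτq := eq_reduce_mul_transition_of_condDiv_eq_zero hτ hν h
  have hνq := fun i => (reduce_mul_transition hν' i).symm
  have hq : ∀ i, 0 < transition ν i := fun i => transition_pos hν' (hν i)
  -- subtract from `τ` the largest multiple of `ν` that leaves the difference nonnegative
  obtain ⟨i₀, hi₀⟩ := Finite.exists_min fun i : Fin s → A => reduce τ i / reduce ν i
  set ρ := reduce τ i₀ / reduce ν i₀ with hρ
  let σ : (Fin (s + 1) → A) → ℝ := fun i => τ i - ρ * ν i
  have hred : ∀ i, reduce σ i = reduce τ i - ρ * reduce ν i := fun i => by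
    simp [reduce, σ, Finset.mul_sum]
  have hσq : ∀ i, σ i = reduce σ (Fin.init i) * transition ν i := fun i => by
    rw [hred, sub_mul, mul_assoc, ← hτq, ← hνq]
  have hr : ∀ i, 0 ≤ reduce σ i := fun i => by
    rw [hred, sub_nonneg, ← le_div_iff₀ (reduce_pos hν i)]
    exact hi₀ i
  have hσ : ∀ i, 0 ≤ σ i := fun i => hσq i ▸ mul_nonneg (hr _) (hq i).le
  have hσi : IsShiftInvariant σ := fun i => by
    rw [hred, hτi, hνi]
    simp [σ, Finset.mul_sum]
  have h0 : reduce σ i₀ = 0 := by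
    rw [hred, hρ, div_mul_cancel₀ _ (reduce_pos hν i₀).ne', sub_self]
  have hσ0 : ∀ i, σ i = 0 := fun i => by
    rw [hσq, reduce_eq_zero_of_exists hσ hσi hq hσq h0, zero_mul]
  have hmul : ∀ i, τ i = ρ * ν i := fun i => sub_eq_zero.1 (hσ0 i)
  have hρ1 : ρ = 1 := by
    have h1 : ∑ i, ν i = ρ * ∑ i, ν i := by
      rw [Finset.mul_sum, ← hsum]
      exact Finset.sum_congr rfl fun i _ => hmul i
    have h2 : 0 < ∑ i, ν i := Finset.sum_pos (fun i _ => hν i) Finset.univ_nonempty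
    exact (mul_right_cancel₀ h2.ne' ((one_mul _).trans h1)).symm
  funext i
  rw [hmul, hρ1, one_mul]

end

section

/-! ### Weights of paths -/

/-- A word of length `l`, continued to a sequence by an arbitrary letter. -/
def extend {A : Type*} [Inhabited A] {l : ℕ} (f : Fin l → A) : ℕ → A :=
  fun u => if h : u < l then f ⟨u, h⟩ else default

lemma extend_snoc_of_lt {A : Type*} [Inhabited A] {l : ℕ} (f : Fin l → A) (j : A) {u : ℕ}
    (hu : u < l) : extend (Fin.snoc f j : Fin (l + 1) → A) u = extend f u := by
  simp [extend, hu, Nat.lt_succ_of_lt hu, Fin.snoc]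

lemma extend_snoc_self {A : Type*} [Inhabited A] {l : ℕ} (f : Fin l → A) (j : A) :
    extend (Fin.snoc f j : Fin (l + 1) → A) l = j := by
  simp [extend, Fin.snoc]

lemma window_zero_extend {A : Type*} [Inhabited A] {l : ℕ} (f : Fin l → A) :
    window l 0 (extend f) = f := by
  funext j
  simp [window, extend]

lemma window_congr {A : Type*} {k t m : ℕ} (htm : t + k ≤ m) {x y : ℕ → A}
    (h : ∀ u < m, x u = y u) : window k t x = window k t y :=
  funext fun j => h _ (by omega)

/-- The sequence that repeats the first `l` letters of `x` with period `l`. -/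
def cyclicPath {A : Type*} (l : ℕ) (x : ℕ → A) : ℕ → A := fun u => x (u % l)

lemma window_cyclicPath_of_le {A : Type*} {k t l : ℕ} (h : t + k ≤ l) (x : ℕ → A) :
    window k t (cyclicPath l x) = window k t x :=
  window_congr h fun u hu => by rw [cyclicPath, Nat.mod_eq_of_lt hu]

/-- The weight of the path `x` up to length `s + n` with initial weight `a` and transition weights
`q`. -/
def pathWeight {A : Type*} {s : ℕ} (a : (Fin s → A) → ℝ) (q : (Fin (s + 1) → A) → ℝ) (n : ℕ)
    (x : ℕ → A) : ℝ :=
  a (window s 0 x) * ∏ t ∈ Finset.range n, q (window (s + 1) t x)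

/-- The product of the transition weights along the closed path of length `l` through the first `l`
letters of `x`. -/
def cycleWeight {A : Type*} {s : ℕ} (q : (Fin (s + 1) → A) → ℝ) (l : ℕ) (x : ℕ → A) : ℝ :=
  ∏ t ∈ Finset.range l, q (window (s + 1) t (cyclicPath l x))

lemma pathWeight_nonneg {A : Type*} {s : ℕ} {a : (Fin s → A) → ℝ} {q : (Fin (s + 1) → A) → ℝ}
    (ha : ∀ i, 0 ≤ a i) (hq : ∀ i, 0 ≤ q i) (n : ℕ) (x : ℕ → A) : 0 ≤ pathWeight a q n x :=
  mul_nonneg (ha _) (Finset.prod_nonneg fun _ _ => hq _)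

lemma pathWeight_zero_extend {A : Type*} [Inhabited A] {s : ℕ} (a : (Fin s → A) → ℝ)
    (q : (Fin (s + 1) → A) → ℝ) (f : Fin (s + 0) → A) : pathWeight a q 0 (extend f) = a f := by
  simp only [pathWeight, Finset.range_zero, Finset.prod_empty, mul_one]
  rw [show window s 0 (extend f) = f from window_zero_extend f]

lemma pathWeight_extend_snoc {A : Type*} [Inhabited A] {s : ℕ} (a : (Fin s → A) → ℝ)
    (q : (Fin (s + 1) → A) → ℝ) (n : ℕ) (f : Fin (s + n) → A) (j : A) :
    pathWeight a q (n + 1) (extend (Fin.snoc f j : Fin (s + n + 1) → A)) =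
      pathWeight a q n (extend f) * q (Fin.snoc (window s n (extend f)) j) := by
  have h : ∀ u < s + n, extend (Fin.snoc f j : Fin (s + n + 1) → A) u = extend f u :=
    fun u hu => extend_snoc_of_lt f j hu
  rw [pathWeight, pathWeight, Finset.prod_range_succ, ← mul_assoc,
    window_congr (by omega) h (k := s), ← snoc_window s n,
    window_congr (by omega) h (k := s) (t := n), add_comm n s, extend_snoc_self]
  congr 2
  exact Finset.prod_congr rfl fun t ht => by
    rw [window_congr (by have := Finset.mem_range.1 ht; omega) h (k := s + 1)]

variable {A : Type*} [Fintype A] [Inhabited A] {s : ℕ}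

lemma sum_pathWeight_le {a : (Fin s → A) → ℝ} {q : (Fin (s + 1) → A) → ℝ}
    (ha : ∀ i, 0 ≤ a i) (hq : ∀ i, 0 ≤ q i) (hsum : ∀ i, ∑ j, q (Fin.snoc i j) ≤ 1) (n : ℕ) :
    ∑ f : Fin (s + n) → A, pathWeight a q n (extend f) ≤ ∑ i, a i := by
  induction n with
  | zero => exact (Finset.sum_congr rfl fun f _ => pathWeight_zero_extend a q f).le
  | succ n ih =>
    refine le_trans ?_ ih
    rw [← add_assoc, sum_snoc]
    refine Finset.sum_le_sum fun f _ => ?_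
    simp_rw [pathWeight_extend_snoc, ← Finset.mul_sum]
    exact mul_le_of_le_one_right (pathWeight_nonneg ha hq _ _) (hsum _)

lemma sum_pathWeight_eq (a : (Fin s → A) → ℝ) {q : (Fin (s + 1) → A) → ℝ}
    (hsum : ∀ i, ∑ j, q (Fin.snoc i j) = 1) (n : ℕ) :
    ∑ f : Fin (s + n) → A, pathWeight a q n (extend f) = ∑ i, a i := by
  induction n with
  | zero => exact Finset.sum_congr rfl fun f _ => pathWeight_zero_extend a q f
  | succ n ih =>
    rw [← ih, ← add_assoc, sum_snoc]
    refine Finset.sum_congr rfl fun f _ => ?_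
    simp_rw [pathWeight_extend_snoc, ← Finset.mul_sum]
    rw [hsum, mul_one]

omit [Fintype A] [Inhabited A] in
/-- Splitting off the `s` transitions that close the path. -/
lemma cycleWeight_eq (q : (Fin (s + 1) → A) → ℝ) (n : ℕ) (x : ℕ → A) :
    cycleWeight q (s + n) x = (∏ t ∈ Finset.range n, q (window (s + 1) t x)) *
      ∏ t ∈ Finset.range s, q (window (s + 1) (n + t) (cyclicPath (s + n) x)) := by
  rw [cycleWeight, add_comm s n, Finset.prod_range_add]
  congr 1
  exact Finset.prod_congr rfl fun t ht => by
    rw [window_cyclicPath_of_le (by have := Finset.mem_range.1 ht; omega)]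

omit [Fintype A] [Inhabited A] in
lemma cycleWeight_le_prod {q : (Fin (s + 1) → A) → ℝ} (h0 : ∀ i, 0 ≤ q i) (h1 : ∀ i, q i ≤ 1)
    (n : ℕ) (x : ℕ → A) :
    cycleWeight q (s + n) x ≤ ∏ t ∈ Finset.range n, q (window (s + 1) t x) := by
  rw [cycleWeight_eq]
  exact mul_le_of_le_one_right (Finset.prod_nonneg fun _ _ => h0 _)
    (Finset.prod_le_one (fun _ _ => h0 _) fun _ _ => h1 _)

omit [Fintype A] [Inhabited A] in
lemma mul_prod_le_cycleWeight {q : (Fin (s + 1) → A) → ℝ} {c : ℝ} (hc : 0 ≤ c)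
    (hq : ∀ i, c ≤ q i) (n : ℕ) (x : ℕ → A) :
    c ^ s * ∏ t ∈ Finset.range n, q (window (s + 1) t x) ≤ cycleWeight q (s + n) x := by
  rw [cycleWeight_eq, mul_comm]
  refine mul_le_mul_of_nonneg_left ?_ (Finset.prod_nonneg fun _ _ => hc.trans (hq _))
  calc c ^ s = ∏ t ∈ Finset.range s, c := by simp
    _ ≤ _ := Finset.prod_le_prod (fun _ _ => hc) fun _ _ => hq _

/-! ### Cyclic empirical frequencies -/

open Classical in
/-- The frequency of each word of length `k` in the cyclic word formed by the first `l` letters of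
`x`. -/
def cyclicFreq {A : Type*} (k l : ℕ) (x : ℕ → A) : (Fin k → A) → ℝ :=
  fun i => (1 / (l : ℝ)) *
    ∑ t ∈ Finset.range l, if window k t (cyclicPath l x) = i then 1 else 0

omit [Fintype A] [Inhabited A] in
lemma cyclicFreq_congr {k l : ℕ} {x y : ℕ → A} (h : ∀ u < l, x u = y u) :
    cyclicFreq k l x = cyclicFreq k l y := by
  rcases l.eq_zero_or_pos with rfl | hl
  · funext i
    simp [cyclicFreq]
  · have : cyclicPath l x = cyclicPath l y := funext fun u => h _ (Nat.mod_lt u hl)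
    unfold cyclicFreq
    rw [this]

omit [Fintype A] [Inhabited A] in
lemma empirical_eq_cyclicFreq {l : ℕ} (hl : s ≤ l) (x : ℕ → A) :
    empirical s l x = cyclicFreq (s + 1) l fun u => x (u + 1) := by
  classical
  funext i
  unfold empirical cyclicFreq
  rw [← Finset.Ico_add_one_right_eq_Icc, Finset.sum_Ico_eq_sum_range]
  congr 1
  refine Finset.sum_congr rfl fun t ht => ?_
  have ht := Finset.mem_range.1 ht
  simp only [funext_iff, window, cyclicPath]
  have : ∀ j : Fin (s + 1), augmentedPath l x (1 + t + j) = x ((t + j) % l + 1) := by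
    intro j
    have hj := j.2
    unfold augmentedPath
    split_ifs with h
    · rw [Nat.mod_eq_of_lt (by omega)]
      congr 1
      omega
    · rw [Nat.mod_eq_sub_mod (by omega), Nat.mod_eq_of_lt (by omega)]
      congr 1
      omega
  simp only [this]

omit [Inhabited A] in
lemma sum_cyclicFreq_mul (k l : ℕ) (x : ℕ → A) (g : (Fin k → A) → ℝ) :
    ∑ i, cyclicFreq k l x i * g i =
      (1 / (l : ℝ)) * ∑ t ∈ Finset.range l, g (window k t (cyclicPath l x)) := by
  classical
  simp only [cyclicFreq, mul_assoc, ← Finset.mul_sum, Finset.sum_mul]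
  rw [Finset.sum_comm]
  simp

omit [Fintype A] [Inhabited A] in
lemma cyclicFreq_nonneg (k l : ℕ) (x : ℕ → A) (i : Fin k → A) : 0 ≤ cyclicFreq k l x i :=
  mul_nonneg (by positivity) (Finset.sum_nonneg fun _ _ => by split_ifs <;> simp)

omit [Inhabited A] in
lemma cyclicFreq_mem_stdSimplex {k l : ℕ} (hl : 0 < l) (x : ℕ → A) :
    cyclicFreq k l x ∈ stdSimplex ℝ (Fin k → A) := by
  refine ⟨cyclicFreq_nonneg k l x, ?_⟩
  have h := sum_cyclicFreq_mul k l x fun _ => 1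
  have : (l : ℝ) ≠ 0 := by positivity
  simpa [this] using h

omit [Inhabited A] in
lemma reduce_cyclicFreq (k l : ℕ) (x : ℕ → A) :
    reduce (cyclicFreq (k + 1) l x) = cyclicFreq k l x := by
  classical
  funext i
  simp only [reduce, cyclicFreq, ← Finset.mul_sum]
  rw [Finset.sum_comm]
  congr 1
  refine Finset.sum_congr rfl fun t _ => ?_
  simp only [← snoc_window k t, Fin.snoc_injective2.eq_iff]
  by_cases h : window k t (cyclicPath l x) = i <;> simp [h]

omit [Inhabited A] in
lemma sum_cons_cyclicFreq (k l : ℕ) (x : ℕ → A) (i : Fin k → A) :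
    ∑ j : A, cyclicFreq (k + 1) l x (Fin.cons j i) = cyclicFreq k l x i := by
  classical
  simp only [cyclicFreq, ← Finset.mul_sum]
  rw [Finset.sum_comm]
  congr 1
  have h1 : ∀ t,
      (∑ j : A, if window (k + 1) t (cyclicPath l x) = Fin.cons j i then (1 : ℝ) else 0) =
      if window k (t + 1) (cyclicPath l x) = i then 1 else 0 := fun t => by
    simp only [← cons_window k t, Fin.cons_injective2.eq_iff]
    by_cases h : window k (t + 1) (cyclicPath l x) = i <;> simp [h]
  simp only [h1]
  have h2 : window k l (cyclicPath l x) = window k 0 (cyclicPath l x) := by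
    funext j
    simp [window, cyclicPath]
  have h3 := Finset.sum_range_succ'
    (fun t => if window k t (cyclicPath l x) = i then (1 : ℝ) else 0) l
  rw [Finset.sum_range_succ, h2] at h3
  exact (add_right_cancel h3).symm

omit [Inhabited A] in
/-- A family of vectors on `k`-tuples, of which each is both the left and the right marginal of the
next, consists of consistent vectors. -/
lemma isConsistent_of_marginals {F : (k : ℕ) → (Fin k → A) → ℝ}
    (h1 : ∀ k, reduce (F (k + 1)) = F k)
    (h2 : ∀ k i, ∑ j : A, F (k + 1) (Fin.cons j i) = F k i) : ∀ k, IsConsistent k (F k)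
  | 0 => trivial
  | 1 => trivial
  | k + 2 => ⟨fun i => (congrFun (h1 (k + 1)) i).trans (h2 (k + 1) i).symm,
      by rw [h1]; exact isConsistent_of_marginals h1 h2 (k + 1)⟩

omit [Inhabited A] in
lemma cyclicFreq_mem_stationaryDist {k l : ℕ} (hl : 0 < l) (x : ℕ → A) :
    cyclicFreq k l x ∈ stationaryDist A k :=
  ⟨cyclicFreq_mem_stdSimplex hl x, isConsistent_of_marginals (F := fun k => cyclicFreq k l x)
    (fun k => reduce_cyclicFreq k l x) (fun k i => sum_cons_cyclicFreq k l x i) k⟩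

omit [Fintype A] [Inhabited A] in
lemma cyclicFreq_window_pos {k l t : ℕ} (ht : t < l) (x : ℕ → A) :
    0 < cyclicFreq k l x (window k t (cyclicPath l x)) := by
  have hl : 0 < l := by omega
  refine mul_pos (by positivity) (Finset.sum_pos' (fun _ _ => by split_ifs <;> simp)
    ⟨t, Finset.mem_range.2 ht, by simp⟩)

omit [Inhabited A] in
/-- The product of the transition weights along a closed path is a function of its frequencies. -/
lemma cycleWeight_eq_exp {q : (Fin (s + 1) → A) → ℝ} {l : ℕ} {x : ℕ → A}
    (hq : ∀ t < l, 0 < q (window (s + 1) t (cyclicPath l x))) :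
    cycleWeight q l x = Real.exp (l * ∑ i, cyclicFreq (s + 1) l x i * Real.log (q i)) := by
  rw [sum_cyclicFreq_mul]
  rcases l.eq_zero_or_pos with rfl | hl
  · simp [cycleWeight]
  · have : (l : ℝ) ≠ 0 := by positivity
    rw [one_div, mul_inv_cancel_left₀ this, Real.exp_sum, cycleWeight]
    exact Finset.prod_congr rfl fun t ht => (Real.exp_log (hq t (Finset.mem_range.1 ht))).symm

open Classical in
/-- The frequency vectors that occur among the words of length `l`. -/
def types (A : Type*) [Fintype A] [Inhabited A] (k l : ℕ) : Finset ((Fin k → A) → ℝ) :=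
  Finset.univ.image fun f : Fin l → A => cyclicFreq k l (extend f)

/-- The number of types of words of length `l` grows polynomially, as every frequency is one of the
`l + 1` fractions with denominator `l`. -/
lemma card_types_le (k l : ℕ) :
    (types A k l).card ≤ (l + 1) ^ Fintype.card (Fin k → A) := by
  classical
  have hsub : types A k l ⊆ Fintype.piFinset fun _ : Fin k → A =>
      (Finset.range (l + 1)).image fun m : ℕ => (1 / (l : ℝ)) * m := by
    intro τ hτ
    obtain ⟨f, -, rfl⟩ := Finset.mem_image.1 hτ
    refine Fintype.mem_piFinset.2 fun i => Finset.mem_image.2 ?_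
    refine ⟨((Finset.range l).filter fun t => window k t (cyclicPath l (extend f)) = i).card,
      Finset.mem_range.2 (Nat.lt_succ_of_le ((Finset.card_filter_le _ _).trans (by simp))), ?_⟩
    simp [cyclicFreq]
  refine (Finset.card_le_card hsub).trans ?_
  rw [Fintype.card_piFinset, Finset.prod_const, Finset.card_univ]
  exact Nat.pow_le_pow_left (Finset.card_image_le.trans (by simp)) _

end

section

/-! ### Stationary distributions -/

section

variable {A : Type*} [Fintype A] {s : ℕ}

lemma IsConsistent.isShiftInvariant {ν : (Fin (s + 1) → A) → ℝ} (h : IsConsistent (s + 1) ν) :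
    IsShiftInvariant ν := by
  cases s with
  | zero =>
    intro i
    refine Finset.sum_congr rfl fun j _ => congrArg ν (funext fun u => ?_)
    rw [Fin.fin_one_eq_zero u, Fin.cons_zero, ← Fin.snoc_last (α := fun _ => A) j i]
    rfl
  | succ s => exact h.1

lemma reduce_combo {k : ℕ} (ν μ : (Fin (k + 1) → A) → ℝ) (a b : ℝ) :
    reduce (a • ν + b • μ) = a • reduce ν + b • reduce μ := by
  funext i
  simp [reduce, Finset.sum_add_distrib, Finset.mul_sum]

lemma IsConsistent.combo : ∀ {k : ℕ} {ν μ : (Fin k → A) → ℝ}, IsConsistent k ν → IsConsistent k μ →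
    ∀ a b : ℝ, IsConsistent k (a • ν + b • μ)
  | 0, _, _, _, _, _, _ => trivial
  | 1, _, _, _, _, _, _ => trivial
  | k + 2, ν, μ, hν, hμ, a, b => ⟨fun i => by
      simp only [Pi.add_apply, Pi.smul_apply, smul_eq_mul, Finset.sum_add_distrib,
        ← Finset.mul_sum, hν.1 i, hμ.1 i], by
      rw [reduce_combo]
      exact hν.2.combo hμ.2 a b⟩

lemma convex_stationaryDist (k : ℕ) : Convex ℝ (stationaryDist A k) :=
  fun _ hν _ hμ a b ha hb hab =>
    ⟨convex_stdSimplex ℝ _ hν.1 hμ.1 ha hb hab, hν.2.combo hμ.2 a b⟩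

lemma reduce_le_one {ν : (Fin (s + 1) → A) → ℝ} (hν : ν ∈ stdSimplex ℝ (Fin (s + 1) → A))
    (i : Fin s → A) : reduce ν i ≤ 1 := by
  rw [← hν.2, ← sum_reduce]
  exact Finset.single_le_sum (fun i _ => reduce_nonneg hν.1 i) (Finset.mem_univ i)

lemma isCompact_simplex_shiftInvariant :
    IsCompact {ν | ν ∈ stdSimplex ℝ (Fin (s + 1) → A) ∧ IsShiftInvariant ν} := by
  refine (isCompact_stdSimplex ℝ _).inter_right ?_
  have : {ν : (Fin (s + 1) → A) → ℝ | IsShiftInvariant ν} =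
      ⋂ i, {ν | reduce ν i = ∑ j : A, ν (Fin.cons j i)} := by
    ext ν
    simp [IsShiftInvariant]
  change IsClosed {ν : (Fin (s + 1) → A) → ℝ | IsShiftInvariant ν}
  rw [this]
  refine isClosed_iInter fun i => isClosed_eq ?_ ?_
  · unfold reduce
    fun_prop
  · fun_prop

end

/-! ### Probability of a type -/

variable {A : Type*} [Fintype A] [Inhabited A] {s : ℕ}

omit [Inhabited A] in
lemma sum_transition_le_one (ν : (Fin (s + 1) → A) → ℝ) (i : Fin s → A) :
    ∑ j, transition ν (Fin.snoc i j) ≤ 1 := by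
  rw [sum_transition]
  exact div_self_le_one _

omit [Inhabited A] in
/-- Along a path with frequencies `τ`, passing from the transition probabilities of `ν` to those of
`τ` itself changes the weight by the factor `exp (-l D_c(τ‖ν))`, up to the boundary terms. -/
lemma pathWeight_le_exp_mul {ν : (Fin (s + 1) → A) → ℝ} (hν : ∀ i, 0 < ν i) {c : ℝ} (hc : 0 < c)
    (hcν : ∀ i, c ≤ transition ν i) {a : (Fin s → A) → ℝ} (ha : ∀ i, a i ≤ 1) (n : ℕ)
    (x : ℕ → A) :
    pathWeight a (transition ν) n x ≤
      (c ^ s)⁻¹ * Real.exp (-((s + n : ℕ) * condDiv (cyclicFreq (s + 1) (s + n) x) ν)) *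
        pathWeight 1 (transition (cyclicFreq (s + 1) (s + n) x)) n x := by
  have hν' : ∀ i, 0 ≤ ν i := fun i => (hν i).le
  set τ := cyclicFreq (s + 1) (s + n) x with hτdef
  have hτ : ∀ i, 0 ≤ τ i := cyclicFreq_nonneg _ _ _
  have h1 : cycleWeight (transition ν) (s + n) x =
      Real.exp (-((s + n : ℕ) * condDiv τ ν)) * cycleWeight (transition τ) (s + n) x := by
    rw [cycleWeight_eq_exp fun t _ => transition_pos hν' (hν _),
      cycleWeight_eq_exp fun t ht => transition_pos hτ (cyclicFreq_window_pos ht x),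
      ← Real.exp_add, condDiv_eq_sum_log_sub hτ, ← hτdef]
    congr 1
    ring
  calc pathWeight a (transition ν) n x
      ≤ ∏ t ∈ Finset.range n, transition ν (window (s + 1) t x) :=
        mul_le_of_le_one_left (Finset.prod_nonneg fun _ _ => transition_nonneg hν' _) (ha _)
    _ ≤ (c ^ s)⁻¹ * cycleWeight (transition ν) (s + n) x := by
        rw [inv_mul_eq_div, le_div_iff₀' (pow_pos hc s)]
        exact mul_prod_le_cycleWeight hc.le hcν n x
    _ = (c ^ s)⁻¹ * Real.exp (-((s + n : ℕ) * condDiv τ ν)) *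
          cycleWeight (transition τ) (s + n) x := by rw [h1, mul_assoc]
    _ ≤ _ := by
        refine mul_le_mul_of_nonneg_left ?_ (by positivity)
        rw [pathWeight, Pi.one_apply, one_mul]
        exact cycleWeight_le_prod (transition_nonneg hτ) (transition_le_one hτ) n x

open Classical in
/-- The total weight of the words of type `τ`: the weights of all words for the transition
probabilities of `τ` add up to at most the number of initial words. -/
lemma sum_pathWeight_type_le {ν : (Fin (s + 1) → A) → ℝ} (hν : ∀ i, 0 < ν i) {c : ℝ} (hc : 0 < c)
    (hcν : ∀ i, c ≤ transition ν i) {a : (Fin s → A) → ℝ} (ha : ∀ i, a i ≤ 1) (n : ℕ)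
    (τ : (Fin (s + 1) → A) → ℝ) :
    ∑ f : Fin (s + n) → A with cyclicFreq (s + 1) (s + n) (extend f) = τ,
        pathWeight a (transition ν) n (extend f) ≤
      (c ^ s)⁻¹ * Fintype.card (Fin s → A) * Real.exp (-((s + n : ℕ) * condDiv τ ν)) := by
  by_cases hex : ∃ f : Fin (s + n) → A, cyclicFreq (s + 1) (s + n) (extend f) = τ
  · have hτ : ∀ i, 0 ≤ τ i := by
      obtain ⟨f, rfl⟩ := hex
      exact cyclicFreq_nonneg _ _ _
    have h1 : ∀ i : Fin s → A, 0 ≤ (1 : (Fin s → A) → ℝ) i := fun _ => zero_le_one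
    calc _ ≤ ∑ f : Fin (s + n) → A with cyclicFreq (s + 1) (s + n) (extend f) = τ,
          (c ^ s)⁻¹ * Real.exp (-((s + n : ℕ) * condDiv τ ν)) *
            pathWeight 1 (transition τ) n (extend f) := by
          refine Finset.sum_le_sum fun f hf => ?_
          have := pathWeight_le_exp_mul hν hc hcν ha n (extend f)
          rwa [(Finset.mem_filter.1 hf).2] at this
      _ ≤ (c ^ s)⁻¹ * Real.exp (-((s + n : ℕ) * condDiv τ ν)) *
            ∑ f : Fin (s + n) → A, pathWeight 1 (transition τ) n (extend f) := by
          rw [← Finset.mul_sum]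
          refine mul_le_mul_of_nonneg_left ?_ (by positivity)
          exact Finset.sum_le_sum_of_subset_of_nonneg (Finset.filter_subset _ _)
            fun f _ _ => pathWeight_nonneg h1 (transition_nonneg hτ) _ _
      _ ≤ (c ^ s)⁻¹ * Real.exp (-((s + n : ℕ) * condDiv τ ν)) * Fintype.card (Fin s → A) := by
          refine mul_le_mul_of_nonneg_left ?_ (by positivity)
          simpa using sum_pathWeight_le h1 (transition_nonneg hτ) (sum_transition_le_one τ) n
      _ = _ := by ring
  · push Not at hex
    rw [Finset.filter_false_of_mem fun f _ => hex f, Finset.sum_empty]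
    positivity

open Classical in
/-- The weight, under the path law determined by `ν`, of the words of length `s + n` whose frequency
vector lies in `F`. -/
def freqProb (ν : (Fin (s + 1) → A) → ℝ) (n : ℕ) (F : Set ((Fin (s + 1) → A) → ℝ)) : ℝ :=
  ∑ f : Fin (s + n) → A with cyclicFreq (s + 1) (s + n) (extend f) ∈ F,
    pathWeight (reduce ν) (transition ν) n (extend f)

/-- Upper bound for the weight of a set of types, by the method of types. -/
lemma exists_freqProb_le {ν : (Fin (s + 1) → A) → ℝ} (hs : 0 < s) (hν : ∀ i, 0 < ν i)
    (hν1 : ∑ i, ν i = 1) :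
    ∃ C : ℝ, ∀ (F : Set ((Fin (s + 1) → A) → ℝ)) (m : ℝ),
      (∀ τ ∈ F, τ ∈ stationaryDist A (s + 1) → m ≤ condDiv τ ν) → ∀ n : ℕ,
      freqProb ν n F ≤ C * (((s + n : ℕ) : ℝ) + 1) ^ Fintype.card (Fin (s + 1) → A) *
        Real.exp (-((s + n : ℕ) * m)) := by
  classical
  have hν' : ∀ i, 0 ≤ ν i := fun i => (hν i).le
  obtain ⟨i₀, hi₀⟩ := Finite.exists_min (transition ν)
  set c := transition ν i₀
  have hc : 0 < c := transition_pos hν' (hν i₀)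
  refine ⟨(c ^ s)⁻¹ * Fintype.card (Fin s → A), fun F m hm n => ?_⟩
  set C := (c ^ s)⁻¹ * Fintype.card (Fin s → A)
  have hC : 0 ≤ C := by positivity
  have hmaps : ∀ f ∈ (Finset.univ.filter fun f : Fin (s + n) → A =>
      cyclicFreq (s + 1) (s + n) (extend f) ∈ F),
      cyclicFreq (s + 1) (s + n) (extend f) ∈ types A (s + 1) (s + n) := fun f _ =>
    Finset.mem_image_of_mem _ (Finset.mem_univ f)
  rw [freqProb, ← Finset.sum_fiberwise_of_maps_to hmaps]
  calc _ ≤ ∑ _τ ∈ types A (s + 1) (s + n), C * Real.exp (-((s + n : ℕ) * m)) := by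
        refine Finset.sum_le_sum fun τ hτ => ?_
        obtain ⟨f₀, -, hf₀⟩ := Finset.mem_image.1 hτ
        by_cases hF : τ ∈ F
        · have hτs : τ ∈ stationaryDist A (s + 1) :=
            hf₀ ▸ cyclicFreq_mem_stationaryDist (by omega) _
          refine le_trans ?_ ((sum_pathWeight_type_le hν hc hi₀ (reduce_le_one ⟨hν', hν1⟩)
            n τ).trans (mul_le_mul_of_nonneg_left (Real.exp_le_exp.2 (neg_le_neg
              (mul_le_mul_of_nonneg_left (hm τ hF hτs) (Nat.cast_nonneg _)))) hC))
          rw [Finset.filter_filter]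
          exact Finset.sum_le_sum_of_subset_of_nonneg
            (fun f hf => by simp only [Finset.mem_filter] at hf ⊢; exact ⟨hf.1, hf.2.2⟩)
            fun f _ _ => pathWeight_nonneg (reduce_nonneg hν') (transition_nonneg hν') _ _
        · refine (Finset.sum_eq_zero fun f hf => ?_).trans_le (by positivity)
          simp only [Finset.mem_filter] at hf
          exact absurd (hf.2 ▸ hf.1.2) hF
    _ ≤ _ := by
        rw [Finset.sum_const, nsmul_eq_mul, mul_left_comm, ← mul_assoc]
        gcongr
        exact_mod_cast card_types_le (A := A) (s + 1) (s + n)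

omit [Fintype A] [Inhabited A] in
lemma tendsto_poly_mul_exp (C : ℝ) (K s : ℕ) {m : ℝ} (hm : 0 < m) :
    Tendsto (fun n : ℕ => C * (((s + n : ℕ) : ℝ) + 1) ^ K * Real.exp (-((s + n : ℕ) * m)))
      atTop (𝓝 0) := by
  have hr : |Real.exp (-m)| < 1 := by
    rw [abs_of_pos (Real.exp_pos _)]
    exact Real.exp_lt_one_iff.2 (by linarith)
  have h := ((tendsto_pow_const_mul_const_pow_of_abs_lt_one K hr).const_mul
    (C * Real.exp m)).comp (tendsto_atTop_mono (fun n => (by omega : n ≤ s + n + 1)) tendsto_id)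
  rw [mul_zero] at h
  refine h.congr fun n => ?_
  simp only [Function.comp_apply]
  rw [← Real.exp_nat_mul]
  have : Real.exp (-((s + n : ℕ) * m)) =
      Real.exp m * Real.exp (((s + n + 1 : ℕ) : ℝ) * -m) := by
    rw [← Real.exp_add]
    congr 1
    push_cast
    ring
  rw [this]
  push_cast
  ring

/-- The exponential upper bound. -/
lemma eventually_freqProb_le {ν : (Fin (s + 1) → A) → ℝ} (hs : 0 < s) (hν : ∀ i, 0 < ν i)
    (hν1 : ∑ i, ν i = 1) {F : Set ((Fin (s + 1) → A) → ℝ)} {m m' : ℝ} (hm' : m' < m)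
    (hm : ∀ τ ∈ F, τ ∈ stationaryDist A (s + 1) → m ≤ condDiv τ ν) :
    ∀ᶠ n in atTop, freqProb ν n F ≤ Real.exp (-((s + n : ℕ) * m')) := by
  obtain ⟨C, h⟩ := exists_freqProb_le hs hν hν1
  filter_upwards [(tendsto_poly_mul_exp C (Fintype.card (Fin (s + 1) → A)) s
    (sub_pos.2 hm')).eventually_le_const zero_lt_one] with n hn
  refine (h F m hm n).trans ?_
  have : Real.exp (-((s + n : ℕ) * m)) =
      Real.exp (-((s + n : ℕ) * (m - m'))) * Real.exp (-((s + n : ℕ) * m')) := by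
    rw [← Real.exp_add]
    congr 1
    ring
  rw [this, ← mul_assoc]
  exact mul_le_of_le_one_left (Real.exp_pos _).le hn

/-! ### Change of measure -/

/-- The weak law of large numbers for the path law determined by `ν`. It follows from the upper
bound, since `D_c(·‖ν)` is bounded away from zero outside a neighbourhood of `ν`. -/
lemma eventually_half_le_freqProb {ν : (Fin (s + 1) → A) → ℝ} (hs : 0 < s) (hν : ∀ i, 0 < ν i)
    (hν1 : ∑ i, ν i = 1) (hνi : IsShiftInvariant ν) {U : Set ((Fin (s + 1) → A) → ℝ)}
    (hU : IsOpen U) (hνU : ν ∈ U) :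
    ∀ᶠ n in atTop, 1 / 2 ≤ freqProb ν n U := by
  have hK := (isCompact_simplex_shiftInvariant (A := A) (s := s)).inter_right hU.isClosed_compl
  obtain ⟨m, hm0, hm⟩ : ∃ m : ℝ, 0 < m ∧ ∀ τ ∈ Uᶜ, τ ∈ stationaryDist A (s + 1) →
      m ≤ condDiv τ ν := by
    rcases ({ν | ν ∈ stdSimplex ℝ (Fin (s + 1) → A) ∧ IsShiftInvariant ν} ∩
      Uᶜ).eq_empty_or_nonempty with he | hne
    · refine ⟨1, one_pos, fun τ hτ hτs => ?_⟩
      exact (Set.eq_empty_iff_forall_notMem.1 he τ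
        ⟨⟨hτs.1, hτs.2.isShiftInvariant⟩, hτ⟩).elim
    · obtain ⟨τ₀, ⟨⟨h1, h2⟩, h3⟩, hmin⟩ :=
        hK.exists_isMinOn hne (continuous_condDiv ν).continuousOn
      refine ⟨condDiv τ₀ ν, (condDiv_nonneg h1.1 hν).lt_of_ne fun h0 => h3 ?_,
        fun τ hτ hτs => hmin ⟨⟨hτs.1, hτs.2.isShiftInvariant⟩, hτ⟩⟩
      rwa [eq_of_condDiv_eq_zero h1.1 hν h2 hνi (h1.2.trans hν1.symm) h0.symm]
  obtain ⟨C, h⟩ := exists_freqProb_le hs hν hν1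
  filter_upwards [(tendsto_poly_mul_exp C (Fintype.card (Fin (s + 1) → A)) s
    hm0).eventually_le_const one_half_pos] with n hn
  have hsum : freqProb ν n U + freqProb ν n Uᶜ = 1 := by
    have ht : ∀ i, ∑ j, transition ν (Fin.snoc i j) = 1 := fun i => by
      rw [sum_transition, div_self (reduce_pos hν i).ne']
    rw [← hν1, ← sum_reduce, ← sum_pathWeight_eq (reduce ν) ht n]
    unfold freqProb
    classical
    convert Finset.sum_filter_add_sum_filter_not Finset.univ
      (fun f : Fin (s + n) → A => cyclicFreq (s + 1) (s + n) (extend f) ∈ U) _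
  have := (h Uᶜ m hm n).trans hn
  linarith

omit [Inhabited A] in
/-- Comparison of the path laws of `μ` and `ν`: up to a constant the density is the exponential of
a linear function of the frequency vector. -/
lemma mul_pathWeight_le_pathWeight {ν μ : (Fin (s + 1) → A) → ℝ} (hν : ∀ i, 0 < ν i)
    (hν1 : ∑ i, ν i = 1) (hμ : ∀ i, 0 < μ i) {a c : ℝ} (ha : 0 < a)
    (haμ : ∀ i, a ≤ reduce μ i) (hc : 0 < c) (hcν : ∀ i, c ≤ transition ν i) (n : ℕ) (x : ℕ → A) :
    a * c ^ s * Real.exp (-((s + n : ℕ) * ∑ i, cyclicFreq (s + 1) (s + n) x i *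
      (Real.log (transition ν i) - Real.log (transition μ i)))) *
        pathWeight (reduce ν) (transition ν) n x ≤ pathWeight (reduce μ) (transition μ) n x := by
  have hν' : ∀ i, 0 ≤ ν i := fun i => (hν i).le
  have hμ' : ∀ i, 0 ≤ μ i := fun i => (hμ i).le
  set g := ∑ i, cyclicFreq (s + 1) (s + n) x i *
      (Real.log (transition ν i) - Real.log (transition μ i)) with hg
  have h1 : cycleWeight (transition μ) (s + n) x =
      Real.exp (-((s + n : ℕ) * g)) * cycleWeight (transition ν) (s + n) x := by
    rw [cycleWeight_eq_exp fun t _ => transition_pos hν' (hν _),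
      cycleWeight_eq_exp fun t _ => transition_pos hμ' (hμ _), ← Real.exp_add, hg]
    simp only [mul_sub, Finset.sum_sub_distrib]
    congr 1
    ring
  calc _ = a * Real.exp (-((s + n : ℕ) * g)) *
          (c ^ s * pathWeight (reduce ν) (transition ν) n x) := by ring
    _ ≤ a * Real.exp (-((s + n : ℕ) * g)) * cycleWeight (transition ν) (s + n) x := by
        refine mul_le_mul_of_nonneg_left (le_trans ?_
          (mul_prod_le_cycleWeight hc.le hcν n x)) (by positivity)
        exact mul_le_mul_of_nonneg_left (mul_le_of_le_one_left
          (Finset.prod_nonneg fun _ _ => transition_nonneg hν' _)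
          (reduce_le_one ⟨hν', hν1⟩ _)) (by positivity)
    _ = a * cycleWeight (transition μ) (s + n) x := by rw [h1, mul_assoc]
    _ ≤ _ := mul_le_mul (haμ _)
        (cycleWeight_le_prod (transition_nonneg hμ') (transition_le_one hμ') n x)
        (Finset.prod_nonneg fun _ _ => transition_nonneg hμ' _) (reduce_nonneg hμ' _)

/-- The exponential lower bound at a positive stationary distribution. -/
lemma eventually_le_freqProb {ν μ : (Fin (s + 1) → A) → ℝ} (hs : 0 < s) (hν : ∀ i, 0 < ν i)
    (hν1 : ∑ i, ν i = 1) (hνi : IsShiftInvariant ν) (hμ : ∀ i, 0 < μ i)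
    {U : Set ((Fin (s + 1) → A) → ℝ)} (hU : IsOpen U) (hνU : ν ∈ U) {m : ℝ}
    (hm : condDiv ν μ < m) :
    ∀ᶠ n in atTop, Real.exp (-((s + n : ℕ) * m)) ≤ freqProb μ n U := by
  have hν' : ∀ i, 0 ≤ ν i := fun i => (hν i).le
  have hμ' : ∀ i, 0 ≤ μ i := fun i => (hμ i).le
  obtain ⟨m', hm1, hm2⟩ := exists_between hm
  let g : ((Fin (s + 1) → A) → ℝ) → ℝ := fun τ =>
    ∑ i, τ i * (Real.log (transition ν i) - Real.log (transition μ i))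
  have hgc : Continuous g := by fun_prop
  have hgν : g ν = condDiv ν μ := by
    simp only [g, mul_sub, Finset.sum_sub_distrib, condDiv_eq_sum_log_sub hν']
  obtain ⟨i₀, hi₀⟩ := Finite.exists_min (transition ν)
  obtain ⟨i₁, hi₁⟩ := Finite.exists_min (reduce μ)
  have hc : 0 < transition ν i₀ := transition_pos hν' (hν i₀)
  have ha : 0 < reduce μ i₁ := reduce_pos hμ i₁
  set c := transition ν i₀
  set a := reduce μ i₁
  have hpos : 0 < a * c ^ s * (1 / 2) := by positivity
  filter_upwards [eventually_half_le_freqProb hs hν hν1 hνi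
    (hU.inter (isOpen_lt hgc continuous_const)) ⟨hνU, hgν.trans_lt hm1⟩,
    (tendsto_poly_mul_exp 1 0 s (sub_pos.2 hm2)).eventually_le_const hpos] with n h1 h2
  have e : Real.exp (-((s + n : ℕ) * m)) =
      Real.exp (-((s + n : ℕ) * (m - m'))) * Real.exp (-((s + n : ℕ) * m')) := by
    rw [← Real.exp_add]
    congr 1
    ring
  rw [pow_zero, one_mul, one_mul] at h2
  calc Real.exp (-((s + n : ℕ) * m))
      ≤ a * c ^ s * (1 / 2) * Real.exp (-((s + n : ℕ) * m')) := by
        rw [e]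
        exact mul_le_mul_of_nonneg_right h2 (Real.exp_pos _).le
    _ = a * c ^ s * Real.exp (-((s + n : ℕ) * m')) * (1 / 2) := by ring
    _ ≤ a * c ^ s * Real.exp (-((s + n : ℕ) * m')) * freqProb ν n (U ∩ {τ | g τ < m'}) :=
        mul_le_mul_of_nonneg_left h1 (by positivity)
    _ ≤ freqProb μ n (U ∩ {τ | g τ < m'}) := by
        rw [freqProb, freqProb, Finset.mul_sum]
        refine Finset.sum_le_sum fun f hf => le_trans ?_
          (mul_pathWeight_le_pathWeight hν hν1 hμ ha hi₁ hc hi₀ n (extend f))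
        have hgf : g (cyclicFreq (s + 1) (s + n) (extend f)) < m' := by
          simp only [Finset.mem_filter] at hf
          exact hf.2.2
        refine mul_le_mul_of_nonneg_right (mul_le_mul_of_nonneg_left (Real.exp_le_exp.2
          (neg_le_neg (mul_le_mul_of_nonneg_left hgf.le (Nat.cast_nonneg _)))) (by positivity))
          (pathWeight_nonneg (reduce_nonneg hν') (transition_nonneg hν') _ _)
    _ ≤ freqProb μ n U :=
        Finset.sum_le_sum_of_subset_of_nonneg
          (fun f hf => by simp only [Finset.mem_filter] at hf ⊢; exact ⟨hf.1, hf.2.1⟩)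
          fun f _ _ => pathWeight_nonneg (reduce_nonneg hμ') (transition_nonneg hμ') _ _

/-- The exponential lower bound at an arbitrary stationary distribution, which is a limit of
positive ones. -/
lemma eventually_le_freqProb_of_mem {ν μ : (Fin (s + 1) → A) → ℝ} (hs : 0 < s)
    (hν : ν ∈ stationaryDist A (s + 1)) (hμ : ∀ i, 0 < μ i)
    (hμs : μ ∈ stationaryDist A (s + 1)) {U : Set ((Fin (s + 1) → A) → ℝ)} (hU : IsOpen U)
    (hνU : ν ∈ U) {m : ℝ} (hm : condDiv ν μ < m) :
    ∀ᶠ n in atTop, Real.exp (-((s + n : ℕ) * m)) ≤ freqProb μ n U := by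
  let φ : ℝ → (Fin (s + 1) → A) → ℝ := fun δ => (1 - δ) • ν + δ • μ
  have hφ : Continuous φ := by fun_prop
  have hφ0 : φ 0 = ν := by simp [φ]
  have hopen : IsOpen {δ | φ δ ∈ U ∧ condDiv (φ δ) μ < m} :=
    (hU.preimage hφ).inter (isOpen_lt ((continuous_condDiv μ).comp hφ) continuous_const)
  have hev : ∀ᶠ δ in 𝓝 (0 : ℝ), φ δ ∈ U ∧ condDiv (φ δ) μ < m :=
    hopen.mem_nhds (by simpa only [Set.mem_ofPred_eq, hφ0] using ⟨hνU, hm⟩)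
  obtain ⟨δ, ⟨h1, h2⟩, h3, h4⟩ := ((hev.filter_mono nhdsWithin_le_nhds).and
    (Ioo_mem_nhdsGT (zero_lt_one' ℝ))).exists
  have hmem : φ δ ∈ stationaryDist A (s + 1) :=
    convex_stationaryDist _ hν hμs (sub_nonneg.2 h4.le) h3.le (by ring)
  exact eventually_le_freqProb hs
    (fun i => add_pos_of_nonneg_of_pos (mul_nonneg (sub_nonneg.2 h4.le) (hν.1.1 i))
      (mul_pos h3 (hμ i))) hmem.1.2 hmem.2.isShiftInvariant hμ hU h1 h2

end

section

/-! ### The law of the process -/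

section

variable {Ω A : Type*} [MeasurableSpace Ω] [Fintype A] [MeasurableSpace A]
  [MeasurableSingletonClass A] {P : Measure Ω} [IsProbabilityMeasure P] {s : ℕ} {X : ℕ → Ω → A}

lemma sum_measureReal_inter_fiber {Y : Ω → A} (hY : Measurable Y) (B : Set Ω) :
    ∑ j, P.real (B ∩ {ω | Y ω = j}) = P.real B := by
  have h := sum_measureReal_preimage_singleton (μ := P.restrict B) Finset.univ
    (f := Y) fun y _ => hY (measurableSet_singleton y)
  rw [Finset.coe_univ, Set.preimage_univ, measureReal_restrict_apply_univ] at h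
  rw [← h]
  refine Finset.sum_congr rfl fun j _ => ?_
  rw [measureReal_restrict_apply (hY (measurableSet_singleton j)), Set.inter_comm]
  rfl

lemma reduce_tupleFreq (hX : ∀ t, Measurable (X t)) (k : ℕ) :
    reduce (tupleFreq P X (k + 1)) = tupleFreq P X k := by
  funext i
  unfold reduce tupleFreq
  rw [← sum_measureReal_inter_fiber (hX k)]
  refine Finset.sum_congr rfl fun j _ => congrArg _ (Set.ext fun ω => ?_)
  simp [Fin.forall_fin_succ']

lemma sum_cons_tupleFreq (hX : ∀ t, Measurable (X t)) (hstat : IsStationary P X) (k : ℕ)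
    (i : Fin k → A) : ∑ j : A, tupleFreq P X (k + 1) (Fin.cons j i) = tupleFreq P X k i := by
  have h : tupleFreq P X k i = P.real {ω | ∀ j : Fin k, X (1 + j) ω = i j} := by
    rw [tupleFreq, measureReal_def, measureReal_def, hstat k 1 i]
  rw [h, ← sum_measureReal_inter_fiber (hX 0)]
  refine Finset.sum_congr rfl fun j _ => congrArg _ (Set.ext fun ω => ?_)
  simp [Fin.forall_fin_succ, and_comm, add_comm]

lemma tupleFreq_mem_stationaryDist (hX : ∀ t, Measurable (X t)) (hstat : IsStationary P X) (k : ℕ) :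
    tupleFreq P X k ∈ stationaryDist A k := by
  refine ⟨⟨fun i => measureReal_nonneg, ?_⟩, isConsistent_of_marginals
    (reduce_tupleFreq hX) (sum_cons_tupleFreq hX hstat) k⟩
  induction k with
  | zero => simp [tupleFreq]
  | succ k ih => rw [← sum_reduce, reduce_tupleFreq hX, ih]

omit [Fintype A] [MeasurableSpace A] [MeasurableSingletonClass A] [IsProbabilityMeasure P] in
lemma measureReal_window (hstat : IsStationary P X) (k t : ℕ) (x : ℕ → A) :
    P.real {ω | ∀ r, t ≤ r → r < t + k → X r ω = x r} = tupleFreq P X k (window k t x) := by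
  have : {ω | ∀ r, t ≤ r → r < t + k → X r ω = x r} =
      {ω | ∀ j : Fin k, X (t + j) ω = window k t x j} := by
    ext ω
    refine ⟨fun h j => h _ (by omega) (by omega), fun h r h1 h2 => ?_⟩
    have := h ⟨r - t, by omega⟩
    rwa [window, Fin.val_mk, Nat.add_sub_cancel' h1] at this
  rw [this, tupleFreq, measureReal_def, measureReal_def, hstat]

omit [Fintype A] in
lemma measurableSet_path (hX : ∀ t, Measurable (X t)) (p : ℕ → Prop) (x : ℕ → A) :
    MeasurableSet {ω | ∀ r, p r → X r ω = x r} := by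
  have : {ω | ∀ r, p r → X r ω = x r} = ⋂ r, ⋂ _ : p r, X r ⁻¹' {x r} := by
    ext ω
    simp
  rw [this]
  exact MeasurableSet.iInter fun r => MeasurableSet.iInter fun _ =>
    hX r (measurableSet_singleton _)

/-- The probability of a path is the product of the transition probabilities. -/
lemma measureReal_path (hX : ∀ t, Measurable (X t)) (hstat : IsStationary P X)
    (hmarkov : IsMultiStepMarkov P s X) (n : ℕ) (x : ℕ → A) :
    P.real {ω | ∀ r, r < s + n → X r ω = x r} =
      pathWeight (reduce (tupleFreq P X (s + 1))) (transition (tupleFreq P X (s + 1))) n x := by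
  induction n with
  | zero =>
    have := measureReal_window hstat s 0 x
    simp only [zero_add, Nat.zero_le, true_imp_iff] at this
    simp [pathWeight, reduce_tupleFreq hX, this]
  | succ n ih =>
    set B := {ω | ∀ r, r < s + n → X r ω = x r} with hB
    set E := {ω | X (s + n) ω = x (s + n)} with hE
    have hBm : MeasurableSet B := measurableSet_path hX (fun r => r < s + n) x
    have hBE : {ω | ∀ r, r < s + (n + 1) → X r ω = x r} = B ∩ E := by
      ext ω
      refine ⟨fun h => ⟨fun r hr => h r (by omega), h _ (by omega)⟩, fun h r hr => ?_⟩
      rcases Nat.lt_succ_iff_lt_or_eq.1 hr with h1 | h1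
      · exact h.1 r h1
      · exact h1 ▸ h.2
    have hstep : pathWeight (reduce (tupleFreq P X (s + 1))) (transition (tupleFreq P X (s + 1)))
        (n + 1) x = P.real B * transition (tupleFreq P X (s + 1)) (window (s + 1) n x) := by
      rw [ih, pathWeight, pathWeight, Finset.prod_range_succ, mul_assoc]
    rw [hBE, hstep]
    by_cases h0 : P B = 0
    · rw [measureReal_def, measureReal_def, h0, measure_mono_null Set.inter_subset_left h0]
      simp
    · have h1 := hmarkov (s + n) (by omega) x h0
      set W := {ω | ∀ r, s + n - s ≤ r → r < s + n → X r ω = x r} with hW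
      have hWm : MeasurableSet W := by
        have := measurableSet_path hX (fun r => s + n - s ≤ r ∧ r < s + n) x
        simpa only [and_imp] using this
      have hWP : P.real W = reduce (tupleFreq P X (s + 1)) (window s n x) := by
        rw [reduce_tupleFreq hX, ← measureReal_window hstat, hW]
        simp only [Nat.add_sub_cancel_left, add_comm]
      have hWE : P.real (W ∩ E) = tupleFreq P X (s + 1) (window (s + 1) n x) := by
        rw [← measureReal_window hstat]
        congr 1
        ext ω
        refine ⟨fun h r h1 h2 => ?_, fun h => ⟨fun r h1 h2 => h r (by omega) (by omega),
          h _ (by omega) (by omega)⟩⟩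
        rcases Nat.lt_succ_iff_lt_or_eq.1 (show r < s + n + 1 by omega) with h3 | h3
        · exact h.1 r (by omega) h3
        · exact h3 ▸ h.2
      have h2 : P[E | B] * P B = P (B ∩ E) := cond_mul_eq_inter hBm E P
      have h3 : P[E | W] = (P W)⁻¹ * P (W ∩ E) := cond_apply hWm P E
      have h4 : P[E | B] = P[E | W] := h1
      rw [measureReal_def, ← h2, h4, h3, transition, init_window, ← hWP, ← hWE]
      simp only [ENNReal.toReal_mul, ENNReal.toReal_inv, measureReal_def]
      ring

/-- The distribution of the empirical frequency vector is that of the cyclic frequencies under the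
path law determined by the tuple frequencies of the process. -/
lemma measureReal_empirical [Inhabited A] (hX : ∀ t, Measurable (X t))
    (hstat : IsStationary P X) (hmarkov : IsMultiStepMarkov P s X) (n : ℕ)
    (F : Set ((Fin (s + 1) → A) → ℝ)) :
    P.real {ω | empirical s (s + n) (fun t => X t ω) ∈ F} =
      freqProb (tupleFreq P X (s + 1)) n F := by
  classical
  let w : Ω → Fin (s + n) → A := fun ω j => X (1 + j) ω
  have hw : ∀ f : Fin (s + n) → A, w ⁻¹' {f} = {ω | ∀ j : Fin (s + n), X (1 + j) ω = f j} :=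
    fun f => Set.ext fun ω => funext_iff
  have hwm : ∀ f : Fin (s + n) → A, MeasurableSet (w ⁻¹' {f}) := fun f => by
    rw [hw, Set.ofPred_forall]
    exact MeasurableSet.iInter fun j => hX _ (measurableSet_singleton (f j))
  have hfreq : ∀ ω, empirical s (s + n) (fun t => X t ω) =
      cyclicFreq (s + 1) (s + n) (extend (w ω)) := fun ω => by
    rw [empirical_eq_cyclicFreq (Nat.le_add_right s n)]
    refine cyclicFreq_congr fun u hu => ?_
    simp [extend, hu, w, add_comm]
  have hP : ∀ f : Fin (s + n) → A, P.real (w ⁻¹' {f}) = pathWeight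
      (reduce (tupleFreq P X (s + 1))) (transition (tupleFreq P X (s + 1))) n (extend f) := by
    intro f
    rw [← measureReal_path hX hstat hmarkov, hw, measureReal_def, hstat, ← measureReal_def]
    congr 1
    ext ω
    refine ⟨fun h r hr => ?_, fun h j => ?_⟩
    · simpa [extend, hr] using h ⟨r, hr⟩
    · simpa [extend] using h j j.2
  rw [freqProb, ← Finset.sum_congr rfl fun f _ => hP f,
    sum_measureReal_preimage_singleton _ fun f _ => hwm f]
  congr 1
  ext ω
  simp [hfreq]

end

/-! ### Logarithmic asymptotics -/

lemma eventually_of_eventually_add {p : ℕ → Prop} (s : ℕ) (h : ∀ᶠ n in atTop, p (s + n)) :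
    ∀ᶠ l in atTop, p l := by
  obtain ⟨N, hN⟩ := eventually_atTop.1 h
  refine eventually_atTop.2 ⟨s + N, fun l hl => ?_⟩
  have := hN (l - s) (by omega)
  rwa [Nat.add_sub_cancel' (by omega)] at this

lemma log_exp_div {l : ℕ} (hl : 0 < l) (m : ℝ) :
    ENNReal.log (ENNReal.ofReal (Real.exp (-(l * m)))) / (l : EReal) = ((-m : ℝ) : EReal) := by
  have h : (l : ℝ) ≠ 0 := by positivity
  rw [ENNReal.log_ofReal_of_pos (Real.exp_pos _), Real.log_exp, ← EReal.coe_coe_eq_natCast,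
    ← EReal.coe_div]
  congr 1
  field_simp

variable {Ω : Type*} [MeasurableSpace Ω] {P : Measure Ω} [IsProbabilityMeasure P]

lemma neg_le_log_div {l : ℕ} (hl : 0 < l) {m : ℝ} {E : Set Ω}
    (h : Real.exp (-(l * m)) ≤ P.real E) :
    ((-m : ℝ) : EReal) ≤ ENNReal.log (P E) / (l : EReal) := by
  rw [← log_exp_div hl, ← ofReal_measureReal (μ := P) (s := E)]
  exact EReal.div_le_div_right_of_nonneg (by positivity)
    (ENNReal.log_le_log (ENNReal.ofReal_le_ofReal h))

lemma log_div_le_neg {l : ℕ} (hl : 0 < l) {m : ℝ} {E : Set Ω}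
    (h : P.real E ≤ Real.exp (-(l * m))) :
    ENNReal.log (P E) / (l : EReal) ≤ ((-m : ℝ) : EReal) := by
  rw [← log_exp_div hl, ← ofReal_measureReal (μ := P) (s := E)]
  exact EReal.div_le_div_right_of_nonneg (by positivity)
    (ENNReal.log_le_log (ENNReal.ofReal_le_ofReal h))

end

end

end MarkovLDP

theorem mainTheorem2 {Ω A : Type*} [MeasurableSpace Ω] [Fintype A]
    [MeasurableSpace A] [MeasurableSingletonClass A]
    (P : Measure Ω) [IsProbabilityMeasure P] (s : ℕ) (hs : 1 ≤ s)
    (X : ℕ → Ω → A) (hX : ∀ t, Measurable (X t))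
    (hstat : MarkovLDP.IsStationary P X) (hmarkov : MarkovLDP.IsMultiStepMarkov P s X)
    (hpos : ∀ i : Fin (s + 1) → A, 0 < MarkovLDP.tupleFreq P X (s + 1) i) :
    MarkovLDP.tupleFreq P X (s + 1) ∈ MarkovLDP.stationaryDist A (s + 1) ∧
    (∀ (l : ℕ), s ≤ l → ∀ ω,
      MarkovLDP.empirical s l (fun t => X t ω) ∈ MarkovLDP.stationaryDist A (s + 1)) ∧
    MarkovLDP.SatisfiesLDP P (MarkovLDP.stationaryDist A (s + 1))
      (fun l ω => MarkovLDP.empirical s l (fun t => X t ω))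
      (fun ν => MarkovLDP.condRelEntropy ν.1 (MarkovLDP.tupleFreq P X (s + 1))) := by
  -- the alphabet is nonempty because the probability space is
  obtain ⟨ω₀⟩ : Nonempty Ω := nonempty_of_isProbabilityMeasure P
  let _ : Inhabited A := ⟨X 0 ω₀⟩
  set μ := MarkovLDP.tupleFreq P X (s + 1)
  have hμ : μ ∈ MarkovLDP.stationaryDist A (s + 1) :=
    MarkovLDP.tupleFreq_mem_stationaryDist hX hstat (s + 1)
  have hemp : ∀ (l : ℕ), s ≤ l → ∀ ω,
      MarkovLDP.empirical s l (fun t => X t ω) ∈ MarkovLDP.stationaryDist A (s + 1) :=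
    fun l hl ω => by
      rw [MarkovLDP.empirical_eq_cyclicFreq hl]
      exact MarkovLDP.cyclicFreq_mem_stationaryDist (by omega) _
  have hP := MarkovLDP.measureReal_empirical hX hstat hmarkov
  have hI : ∀ ν, MarkovLDP.condRelEntropy ν μ = ((MarkovLDP.condDiv ν μ : ℝ) : EReal) :=
    fun ν => MarkovLDP.condRelEntropy_eq ν hpos
  refine ⟨hμ, hemp, ?_, ?_, ?_, ?_, ?_⟩
  · exact eventually_atTop.2 ⟨s, hemp⟩
  · intro ν
    simp only [hI]
    exact EReal.coe_ne_bot _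
  · simp only [hI]
    exact (continuous_coe_real_ereal.comp
      ((MarkovLDP.continuous_condDiv μ).comp continuous_subtype_val)).lowerSemicontinuous
  · intro Γ hΓ
    obtain ⟨V, hV, rfl⟩ := isOpen_induced_iff.1 hΓ
    rw [EReal.neg_le]
    refine le_iInf₂ fun ν hν => ?_
    rw [EReal.neg_le, hI]
    refine EReal.ge_of_forall_gt_iff_ge.1 fun c hc => ?_
    rw [← EReal.coe_neg, EReal.coe_lt_coe_iff, lt_neg] at hc
    refine le_liminf_of_le (h := MarkovLDP.eventually_of_eventually_add s ?_)
    filter_upwards [MarkovLDP.eventually_le_freqProb_of_mem hs ν.2 hpos hμ hV hν hc] with n hn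
    -- the frequencies lie in the subspace, so `V` may replace its trace there
    have hV' : {ω | MarkovLDP.empirical s (s + n) (fun t => X t ω) ∈
        Subtype.val '' (Subtype.val ⁻¹' V : Set (MarkovLDP.stationaryDist A (s + 1)))} =
        {ω | MarkovLDP.empirical s (s + n) (fun t => X t ω) ∈ V} := by
      ext ω
      simp [hemp (s + n) (Nat.le_add_right s n) ω]
    rw [← hP, ← hV'] at hn
    simpa only [neg_neg] using MarkovLDP.neg_le_log_div (by omega) hn
  · intro Γ _
    simp only [hI]
    refine EReal.le_of_forall_lt_iff_le.1 fun c hc => ?_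
    rw [EReal.neg_lt_comm] at hc
    obtain ⟨m, hm1, hm2⟩ := EReal.lt_iff_exists_real_btwn.1 hc
    rw [← EReal.coe_neg, EReal.coe_lt_coe_iff] at hm1
    have hm : ∀ τ ∈ (Subtype.val '' Γ : Set ((Fin (s + 1) → A) → ℝ)),
        τ ∈ MarkovLDP.stationaryDist A (s + 1) → m ≤ MarkovLDP.condDiv τ μ := by
      rintro _ ⟨ν, hν, rfl⟩ -
      exact EReal.coe_le_coe_iff.1 (hm2.le.trans (iInf₂_le ν hν))
    refine limsup_le_of_le (h := MarkovLDP.eventually_of_eventually_add s ?_)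
    filter_upwards [MarkovLDP.eventually_freqProb_le hs hpos hμ.1.2 hm1 hm] with n hn
    rw [← hP] at hn
    simpa only [neg_neg] using MarkovLDP.log_div_le_neg (by omega) hn
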